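/- Let $(\Omega_n)_{n\in\mathbb N}$ be an increasing sequence of open subsets of $\mathbb R^d$ and let $\Omega := \bigcup_{n\in\mathbb N}\Omega_n$. Fix $\lambda>0$ and $f\in L_2(\Omega)$ (functions are complex-valued). For an open set $U\subseteq\mathbb R^d$ let $H^1_0(U)$ be the closure of $C_c^\infty(U)$ in $H^1(\mathbb R^d)$, where functions on $U$ are identified with their extensions by zero to $\mathbb R^d$. A weak solution of the Dirichlet problem $\lambda w-\Delta w=f$ in $U$, $w=0$ on $\partial U$, is a function $w\in H^1_0(U)$ such that $$\lambda\int_U w\,\overline v+\int_U\nabla w\cdot\overline{\nabla v}=\int_U f\,\overline v\qquad\text{for all } v\in H^1_0(U).$$ Then for every $n\in\mathbb N$ the Dirichlet problem $$\lambda u_n-\Delta u_n=f\ \text{ in }\Omega_n,\qquad u_n=0\ \text{ on }\partial\Omega_n,$$ has a unique weak solution $u_n\in H^1_0(\Omega_n)$, the Dirichlet problem $$\lambda u-\Delta u=f\ \text{ in }\Omega,\qquad u=0\ \text{ on }\partial\Omega,$$ has a unique weak solution $u\in H^1_0(\Omega)$, and $$\lim_{n\to\infty}\|u_n-u\|_{L_2(\mathbb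 R^d)}=0.$$ -/

import Mathlib

open MeasureTheory Filter Topology TopologicalSpace
open scoped Distributions

noncomputable section

/-- The space `L₂(ℝᵈ)` of complex-valued square integrable functions. -/
abbrev L2Space (d : ℕ) : Type :=
  Lp ℂ 2 (volume : Measure (EuclideanSpace ℝ (Fin d)))

/-- The classical partial derivative `∂ᵢ φ`. -/
def partialDeriv {d : ℕ} (i : Fin d) (φ : EuclideanSpace ℝ (Fin d) → ℂ)
    (x : EuclideanSpace ℝ (Fin d)) : ℂ :=
  fderiv ℝ φ x (EuclideanSpace.single i 1)

/-- `g` is the weak (distributional) `i`-th partial derivative of `u` on `ℝᵈ`. Note that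
`𝓓(⊤, ℂ)` is the space `C_c^∞(ℝᵈ)`. -/
def HasWeakPartialDeriv {d : ℕ} (i : Fin d) (u g : L2Space d) : Prop :=
  ∀ φ : 𝓓((⊤ : Opens (EuclideanSpace ℝ (Fin d))), ℂ),
    ∫ x, u x * partialDeriv i φ x = -∫ x, g x * φ x

/-- An `L₂` function is integrable against continuous functions with compact support. -/
lemma integrable_L2Space_mul {d : ℕ} (u : L2Space d) {ψ : EuclideanSpace ℝ (Fin d) → ℂ}
    (hψ : Continuous ψ) (hc : HasCompactSupport ψ) : Integrable (fun x => u x * ψ x) :=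
  MemLp.integrable_mul (p := 2) (q := 2) (Lp.memLp u) (hψ.memLp_of_hasCompactSupport hc)

lemma continuous_partialDeriv {d : ℕ} (i : Fin d)
    (φ : 𝓓((⊤ : Opens (EuclideanSpace ℝ (Fin d))), ℂ)) : Continuous (partialDeriv i φ) :=
  (φ.contDiff.continuous_fderiv (by simp)).clm_apply continuous_const

lemma hasCompactSupport_partialDeriv {d : ℕ} (i : Fin d)
    (φ : 𝓓((⊤ : Opens (EuclideanSpace ℝ (Fin d))), ℂ)) : HasCompactSupport (partialDeriv i φ) :=
  φ.hasCompactSupport.fderiv_apply (𝕜 := ℝ) _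

lemma HasWeakPartialDeriv.zero {d : ℕ} (i : Fin d) :
    HasWeakPartialDeriv i (0 : L2Space d) 0 := by
  intro φ
  have h : ∀ ψ : EuclideanSpace ℝ (Fin d) → ℂ,
      ∫ x, (0 : L2Space d) x * ψ x = 0 := fun ψ => by
    rw [integral_congr_ae (g := fun _ => (0 : ℂ)), integral_zero]
    filter_upwards [Lp.coeFn_zero ℂ 2 (volume : Measure (EuclideanSpace ℝ (Fin d)))] with x hx
    simp
  rw [h, h, neg_zero]

lemma HasWeakPartialDeriv.add {d : ℕ} {i : Fin d} {u v g h : L2Space d}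
    (hu : HasWeakPartialDeriv i u g) (hv : HasWeakPartialDeriv i v h) :
    HasWeakPartialDeriv i (u + v) (g + h) := by
  intro φ
  have key : ∀ (a b : L2Space d) {ψ : EuclideanSpace ℝ (Fin d) → ℂ}, Continuous ψ →
      HasCompactSupport ψ → ∫ x, (a + b) x * ψ x = (∫ x, a x * ψ x) + ∫ x, b x * ψ x := by
    intro a b ψ h1 h2
    rw [← integral_add (integrable_L2Space_mul a h1 h2) (integrable_L2Space_mul b h1 h2)]
    refine integral_congr_ae ?_
    filter_upwards [Lp.coeFn_add a b] with x hx
    simp only [hx, Pi.add_apply, add_mul]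
  rw [key u v (continuous_partialDeriv i φ) (hasCompactSupport_partialDeriv i φ),
    key g h φ.continuous φ.hasCompactSupport, hu φ, hv φ, neg_add]

lemma HasWeakPartialDeriv.smul {d : ℕ} {i : Fin d} {u g : L2Space d} (c : ℂ)
    (hu : HasWeakPartialDeriv i u g) : HasWeakPartialDeriv i (c • u) (c • g) := by
  intro φ
  have key : ∀ (a : L2Space d) (ψ : EuclideanSpace ℝ (Fin d) → ℂ),
      ∫ x, (c • a) x * ψ x = c * ∫ x, a x * ψ x := by
    intro a ψ
    rw [← integral_const_mul]
    refine integral_congr_ae ?_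
    filter_upwards [Lp.coeFn_smul c a] with x hx
    simp only [hx, Pi.smul_apply, smul_eq_mul, mul_assoc]
  rw [key, key, hu φ, mul_neg]

/-- The Sobolev space `H¹(ℝᵈ)` of all `u ∈ L₂(ℝᵈ)` whose weak partial derivatives exist in
`L₂(ℝᵈ)`. A function `u` is stored together with its (unique) weak gradient, as the pair `(u, ∇u)`
in the Hilbert space `L₂(ℝᵈ) × L₂(ℝᵈ)ᵈ`, so that the norm is the usual one,
`‖u‖² = ‖u‖²_{L₂} + ∑ᵢ ‖∂ᵢu‖²_{L₂}`. -/
def SobolevH1 (d : ℕ) :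
    Submodule ℂ (WithLp 2 (L2Space d × PiLp 2 (fun _ : Fin d => L2Space d))) where
  carrier := {U | ∀ i, HasWeakPartialDeriv i U.fst (U.snd i)}
  zero_mem' := fun i => HasWeakPartialDeriv.zero i
  add_mem' := fun hU hV i => (hU i).add (hV i)
  smul_mem' := fun c _ hU i => (hU i).smul c

/-- The underlying `L₂` function `u` of `u ∈ H¹(ℝᵈ)`. -/
def sobolevFun {d : ℕ} (u : SobolevH1 d) : L2Space d := u.1.fst

/-- The weak partial derivative `∂ᵢu` of `u ∈ H¹(ℝᵈ)`. -/
def weakDeriv {d : ℕ} (u : SobolevH1 d) (i : Fin d) : L2Space d := u.1.snd i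

/-- `C_c^∞(Ω)` as a subspace of `H¹(ℝᵈ)` (functions on `Ω` are extended by zero). -/
def testFunctionsH1 {d : ℕ} (Ω : Opens (EuclideanSpace ℝ (Fin d))) :
    Submodule ℂ (SobolevH1 d) where
  carrier := {u | ∃ φ : 𝓓(Ω, ℂ), sobolevFun u =ᵐ[volume] φ}
  zero_mem' := ⟨0, by
    exact Lp.coeFn_zero ℂ 2 (volume : Measure (EuclideanSpace ℝ (Fin d)))⟩
  add_mem' := by
    rintro u v ⟨φ, hφ⟩ ⟨ψ, hψ⟩
    refine ⟨φ + ψ, (Lp.coeFn_add (sobolevFun u) (sobolevFun v)).trans ?_⟩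
    filter_upwards [hφ, hψ] with x h1 h2
    simp [h1, h2]
  smul_mem' := by
    rintro c u ⟨φ, hφ⟩
    refine ⟨c • φ, (Lp.coeFn_smul c (sobolevFun u)).trans ?_⟩
    filter_upwards [hφ] with x h1
    simp [h1]

/-- The Sobolev space `H¹₀(Ω)`, the closure of `C_c^∞(Ω)` in `H¹(ℝᵈ)`. Its elements are functions
on `ℝᵈ` (extension by zero outside `Ω`). -/
def SobolevH10 {d : ℕ} (Ω : Opens (EuclideanSpace ℝ (Fin d))) : Submodule ℂ (SobolevH1 d) :=
  (testFunctionsH1 Ω).topologicalClosure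

/-- `u` is a weak solution of the Dirichlet problem `lam • u - Δu = f` in `Ω`, `u = 0` on `∂Ω`:
`u ∈ H¹₀(Ω)` and
`lam ∫_Ω u conj(v) + ∫_Ω ∇u · conj(∇v) = ∫_Ω f conj(v)` for all `v ∈ H¹₀(Ω)`. -/
def IsWeakDirichletSolution {d : ℕ} (Ω : Opens (EuclideanSpace ℝ (Fin d))) (lam : ℝ)
    (f : EuclideanSpace ℝ (Fin d) → ℂ) (u : SobolevH1 d) : Prop :=
  u ∈ SobolevH10 Ω ∧ ∀ v ∈ SobolevH10 Ω,
    (lam : ℂ) * (∫ x in (Ω : Set (EuclideanSpace ℝ (Fin d))),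
        sobolevFun u x * (starRingEnd ℂ) (sobolevFun v x)) +
      ∑ i, (∫ x in (Ω : Set (EuclideanSpace ℝ (Fin d))),
        weakDeriv u i x * (starRingEnd ℂ) (weakDeriv v i x)) =
      ∫ x in (Ω : Set (EuclideanSpace ℝ (Fin d))), f x * (starRingEnd ℂ) (sobolevFun v x)

end

/-! The map `u ↦ (c u, ∇u)`, with `|c|² = lam`, turns the form `lam ⟨u, v⟩ + ⟨∇u, ∇v⟩` into the
inner product of the Hilbert space `L₂ × L₂ᵈ`. Elements of `H¹₀(Ω)` and their gradients vanish a.e.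
off `Ω`, so integrals over `Ω` are inner products over the whole space. Hence `u` is a weak solution
exactly when its image is the orthogonal projection of the single vector `(f / conj c, 0)` onto the
closed image of `H¹₀(Ω)` (`isWeakDirichletSolution_iff`), which gives existence and uniqueness.

By compactness of supports, the subspace for the union is the closure of the union of the increasing
subspaces for the `Ω n` (`scaledH10_iSup`). Projections onto increasing subspaces converge strongly
to the projection onto that closure, so `u n → u` even in `H¹`. -/

/-- Pairing with a continuous compactly supported function is continuous on `L₂`. -/
lemma continuous_integral_L2Space_mul {d : ℕ} {ψ : EuclideanSpace ℝ (Fin d) → ℂ}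
    (hψ : Continuous ψ) (hc : HasCompactSupport ψ) :
    Continuous fun u : L2Space d => ∫ x, u x * ψ x := by
  -- The conjugate compensates for the conjugate-linear first slot of `inner`.
  have hm : MemLp (fun x => (starRingEnd ℂ) (ψ x)) 2
      (volume : Measure (EuclideanSpace ℝ (Fin d))) :=
    (Complex.continuous_conj.comp hψ).memLp_of_hasCompactSupport
      (hc.comp_left (g := starRingEnd ℂ) (map_zero _))
  have h : (fun u : L2Space d => ∫ x, u x * ψ x) = fun u => inner ℂ (hm.toLp _) u := by
    funext u
    rw [L2.inner_def]
    refine integral_congr_ae ?_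
    filter_upwards [hm.coeFn_toLp] with x hx
    simp [hx]
  rw [h]
  fun_prop

/-- For each fixed test function, both sides of the defining identity are continuous in the pair. -/
lemma isClosed_sobolevH1 (d : ℕ) :
    IsClosed (SobolevH1 d :
      Set (WithLp 2 (L2Space d × PiLp 2 (fun _ : Fin d => L2Space d)))) := by
  have h : (SobolevH1 d : Set (WithLp 2 (L2Space d × PiLp 2 (fun _ : Fin d => L2Space d)))) =
      ⋂ (i : Fin d) (φ : 𝓓((⊤ : Opens (EuclideanSpace ℝ (Fin d))), ℂ)),
        {U | ∫ x, U.fst x * partialDeriv i φ x = -∫ x, U.snd i x * φ x} := by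
    ext U
    simp only [Set.mem_iInter, Set.mem_ofPred_eq]
    rfl
  rw [h]
  refine isClosed_iInter fun i => isClosed_iInter fun φ => isClosed_eq ?_ ?_
  · exact (continuous_integral_L2Space_mul (continuous_partialDeriv i φ)
      (hasCompactSupport_partialDeriv i φ)).comp (WithLp.prod_continuous_ofLp 2 _ _).fst
  · refine ((continuous_integral_L2Space_mul φ.continuous φ.hasCompactSupport).comp ?_).neg
    exact (PiLp.continuous_apply 2 _ i).comp (WithLp.prod_continuous_ofLp 2 _ _).snd

/-! ### Vanishing outside `Ω` -/

/-- The weak derivatives of a function that vanishes on an open set vanish there too. -/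
lemma HasWeakPartialDeriv.ae_eq_zero {d : ℕ} {i : Fin d} {u g : L2Space d}
    (h : HasWeakPartialDeriv i u g) {V : Set (EuclideanSpace ℝ (Fin d))} (hV : IsOpen V)
    (hu : ∀ᵐ x, x ∈ V → u x = 0) : ∀ᵐ x, x ∈ V → g x = 0 := by
  refine hV.ae_eq_zero_of_integral_contDiff_smul_eq_zero
    (((Lp.memLp g).locallyIntegrable (by norm_num)).locallyIntegrableOn V) fun η hη hc hs => ?_
  let φ : 𝓓((⊤ : Opens (EuclideanSpace ℝ (Fin d))), ℂ) :=
    { toFun := fun x => (η x : ℂ)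
      contDiff' := Complex.ofRealCLM.contDiff.comp hη
      hasCompactSupport' := hc.comp_left (g := ((↑) : ℝ → ℂ)) Complex.ofReal_zero
      tsupport_subset' := Set.subset_univ _ }
  have hφ : ∀ x, φ x = (η x : ℂ) := fun _ => rfl
  have hsupp : tsupport (φ : EuclideanSpace ℝ (Fin d) → ℂ) ⊆ V :=
    (closure_mono fun x hx => by
      rw [Function.mem_support] at hx ⊢
      exact fun h0 => hx (by rw [hφ, h0, Complex.ofReal_zero])).trans hs
  have h0 : ∫ x, u x * partialDeriv i φ x = 0 := by
    rw [integral_eq_zero_of_ae]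
    filter_upwards [hu] with x hx
    by_cases hxV : x ∈ V
    · simp [hx hxV]
    · have : fderiv ℝ φ x = 0 := by
        by_contra hne
        exact hxV (hsupp (support_fderiv_subset ℝ hne))
      simp [partialDeriv, this]
  have h1 := h φ
  rw [h0, zero_eq_neg] at h1
  rw [← h1]
  refine integral_congr_ae (ae_of_all _ fun x => ?_)
  simp [hφ, mul_comm]

/-- Vanishing almost everywhere on a set is a closed condition in `L₂`. -/
lemma isClosed_setOf_ae_eq_zero {d : ℕ} (s : Set (EuclideanSpace ℝ (Fin d)))
    (hs : MeasurableSet s) :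
    IsClosed {u : L2Space d | ∀ᵐ x, x ∈ s → u x = 0} := by
  have h : {u : L2Space d | ∀ᵐ x, x ∈ s → u x = 0} =
      (LpToLpRestrictCLM (EuclideanSpace ℝ (Fin d)) ℂ ℂ volume 2 s) ⁻¹' {0} := by
    ext u
    rw [Set.mem_ofPred_eq, Set.mem_preimage, Set.mem_singleton_iff, Lp.eq_zero_iff_ae_eq_zero,
      ← ae_restrict_iff' hs]
    have hu := LpToLpRestrictCLM_coeFn (μ := volume) (p := 2) ℂ s u
    exact ⟨fun h => hu.trans h, fun h => hu.symm.trans h⟩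
  rw [h]
  exact isClosed_singleton.preimage (ContinuousLinearMap.continuous _)

lemma continuous_sobolevFun (d : ℕ) : Continuous (sobolevFun : SobolevH1 d → L2Space d) :=
  (WithLp.prod_continuous_ofLp 2 _ _).fst.comp continuous_subtype_val

lemma continuous_weakDeriv {d : ℕ} (i : Fin d) :
    Continuous fun u : SobolevH1 d => weakDeriv u i :=
  (PiLp.continuous_apply 2 _ i).comp
    ((WithLp.prod_continuous_ofLp 2 _ _).snd.comp continuous_subtype_val)

/-- Since `Ωᶜ` is not open, the weak derivatives are handled on the larger open set `(tsupport φ)ᶜ`.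
This also covers a boundary of positive measure. -/
lemma ae_eq_zero_of_mem_testFunctionsH1 {d : ℕ} {Ω : Opens (EuclideanSpace ℝ (Fin d))}
    {u : SobolevH1 d} (hu : u ∈ testFunctionsH1 Ω) :
    (∀ᵐ x, x ∈ (Ω : Set (EuclideanSpace ℝ (Fin d)))ᶜ → sobolevFun u x = 0) ∧
      ∀ i, ∀ᵐ x, x ∈ (Ω : Set (EuclideanSpace ℝ (Fin d)))ᶜ → weakDeriv u i x = 0 := by
  obtain ⟨φ, hφ⟩ := hu
  have h0 : ∀ᵐ x, x ∈ (tsupport φ)ᶜ → sobolevFun u x = 0 := by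
    filter_upwards [hφ] with x hx hxs
    rw [hx]
    exact image_eq_zero_of_notMem_tsupport hxs
  have hsub := Set.compl_subset_compl.2 φ.tsupport_subset
  refine ⟨h0.mono fun x hx hxΩ => hx (hsub hxΩ), fun i => ?_⟩
  exact (HasWeakPartialDeriv.ae_eq_zero (u.2 i) (isClosed_tsupport _).isOpen_compl h0).mono
    fun x hx hxΩ => hx (hsub hxΩ)

lemma ae_eq_zero_of_mem_sobolevH10 {d : ℕ} {Ω : Opens (EuclideanSpace ℝ (Fin d))}
    {u : SobolevH1 d} (hu : u ∈ SobolevH10 Ω) :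
    (∀ᵐ x, x ∈ (Ω : Set (EuclideanSpace ℝ (Fin d)))ᶜ → sobolevFun u x = 0) ∧
      ∀ i, ∀ᵐ x, x ∈ (Ω : Set (EuclideanSpace ℝ (Fin d)))ᶜ → weakDeriv u i x = 0 := by
  have hcl := isClosed_setOf_ae_eq_zero _ Ω.isOpen.measurableSet.compl
  exact ⟨closure_minimal (fun v hv => (ae_eq_zero_of_mem_testFunctionsH1 hv).1)
      (hcl.preimage (continuous_sobolevFun d)) hu,
    fun i => closure_minimal (fun v hv => (ae_eq_zero_of_mem_testFunctionsH1 hv).2 i)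
      (hcl.preimage (continuous_weakDeriv i)) hu⟩

lemma setIntegral_mul_conj_eq_inner {d : ℕ} (s : Set (EuclideanSpace ℝ (Fin d)))
    (u v : L2Space d) (hv : ∀ᵐ x, x ∈ sᶜ → v x = 0) :
    ∫ x in s, u x * (starRingEnd ℂ) (v x) = inner ℂ v u := by
  rw [L2.inner_def, setIntegral_eq_integral_of_ae_compl_eq_zero]
  · simp
  · filter_upwards [hv] with x hx hxs
    simp [hx hxs]

/-! ### The form as a Hilbert space inner product -/

/-- The rescaling `(u, g) ↦ (c u, g)` of `L₂(ℝᵈ) × L₂(ℝᵈ)ᵈ`. -/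
noncomputable def scaleFst (d : ℕ) (c : ℂˣ) :
    WithLp 2 (L2Space d × PiLp 2 (fun _ : Fin d => L2Space d)) ≃L[ℂ]
      WithLp 2 (L2Space d × PiLp 2 (fun _ : Fin d => L2Space d)) :=
  (WithLp.prodContinuousLinearEquiv 2 ℂ _ _).trans
    (((ContinuousLinearEquiv.smulLeft (R₁ := ℂ) c).prodCongr
      (ContinuousLinearEquiv.refl ℂ _)).trans (WithLp.prodContinuousLinearEquiv 2 ℂ _ _).symm)

/-- The map `u ↦ (c u, ∇u)` from `H¹(ℝᵈ)` to `L₂(ℝᵈ) × L₂(ℝᵈ)ᵈ`. -/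
noncomputable def scaledGraph (d : ℕ) (c : ℂˣ) :
    SobolevH1 d →L[ℂ] WithLp 2 (L2Space d × PiLp 2 (fun _ : Fin d => L2Space d)) :=
  (scaleFst d c : _ →L[ℂ] _).comp (SobolevH1 d).subtypeL

lemma isClosedEmbedding_scaledGraph (d : ℕ) (c : ℂˣ) :
    IsClosedEmbedding (scaledGraph d c) :=
  (scaleFst d c).toHomeomorph.isClosedEmbedding.comp
    (isClosed_sobolevH1 d).isClosedEmbedding_subtypeVal

/-- The image of `H¹₀(Ω)` under `u ↦ (c u, ∇u)`. -/
noncomputable def scaledH10 {d : ℕ} (c : ℂˣ) (Ω : Opens (EuclideanSpace ℝ (Fin d))) :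
    Submodule ℂ (WithLp 2 (L2Space d × PiLp 2 (fun _ : Fin d => L2Space d))) :=
  (SobolevH10 Ω).map (scaledGraph d c : SobolevH1 d →ₗ[ℂ] _)

/-- A closed embedding commutes with closures. This gives closedness of the image and reduces
inclusions to test functions. -/
lemma scaledH10_eq_topologicalClosure {d : ℕ} (c : ℂˣ)
    (Ω : Opens (EuclideanSpace ℝ (Fin d))) :
    scaledH10 c Ω = ((testFunctionsH1 Ω).map
      (scaledGraph d c : SobolevH1 d →ₗ[ℂ] _)).topologicalClosure := by
  apply SetLike.coe_injective
  exact ((isClosedEmbedding_scaledGraph d c).closure_image_eq _).symm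

lemma isClosed_scaledH10 {d : ℕ} (c : ℂˣ) (Ω : Opens (EuclideanSpace ℝ (Fin d))) :
    IsClosed (scaledH10 c Ω : Set (WithLp 2 (L2Space d × PiLp 2 (fun _ : Fin d => L2Space d)))) := by
  rw [scaledH10_eq_topologicalClosure]
  exact Submodule.isClosed_topologicalClosure _

instance {d : ℕ} (c : ℂˣ) (Ω : Opens (EuclideanSpace ℝ (Fin d))) :
    (scaledH10 c Ω).HasOrthogonalProjection :=
  haveI := (isClosed_scaledH10 c Ω).completeSpace_coe
  inferInstance

/-! ### Increasing sequences of open sets -/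

lemma testFunctionsH1_mono {d : ℕ} : Monotone (testFunctionsH1 (d := d)) := by
  rintro Ω Ω' h u ⟨φ, hφ⟩
  exact ⟨⟨φ, φ.contDiff, φ.hasCompactSupport, φ.tsupport_subset.trans h⟩, hφ⟩

lemma sobolevH10_mono {d : ℕ} : Monotone (SobolevH10 (d := d)) :=
  fun _ _ h => Submodule.topologicalClosure_mono (testFunctionsH1_mono h)

lemma scaledH10_mono {d : ℕ} (c : ℂˣ) : Monotone (scaledH10 (d := d) c) :=
  fun _ _ h => Submodule.map_mono (sobolevH10_mono h)

/-- A test function on the union of an increasing sequence of open sets is supported in one of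
them. -/
lemma exists_mem_testFunctionsH1 {d : ℕ} {Ω : ℕ → Opens (EuclideanSpace ℝ (Fin d))}
    (hΩ : Monotone Ω) {u : SobolevH1 d} (hu : u ∈ testFunctionsH1 (⨆ n, Ω n)) :
    ∃ n, u ∈ testFunctionsH1 (Ω n) := by
  obtain ⟨φ, hφ⟩ := hu
  obtain ⟨n, hn⟩ := φ.hasCompactSupport.isCompact.elim_directed_cover
    (fun n => (Ω n : Set (EuclideanSpace ℝ (Fin d)))) (fun n => (Ω n).isOpen)
    (φ.tsupport_subset.trans (Opens.coe_iSup Ω).subset)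
    (Monotone.directed_le fun _ _ h => hΩ h)
  exact ⟨n, ⟨φ, φ.contDiff, φ.hasCompactSupport, hn⟩, hφ⟩

lemma scaledH10_iSup {d : ℕ} (c : ℂˣ) {Ω : ℕ → Opens (EuclideanSpace ℝ (Fin d))}
    (hΩ : Monotone Ω) :
    scaledH10 c (⨆ n, Ω n) = (⨆ n, scaledH10 c (Ω n)).topologicalClosure := by
  apply le_antisymm
  · rw [scaledH10_eq_topologicalClosure]
    refine Submodule.topologicalClosure_mono ?_
    rintro _ ⟨u, hu, rfl⟩
    obtain ⟨n, hn⟩ := exists_mem_testFunctionsH1 hΩ hu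
    exact Submodule.mem_iSup_of_mem n ⟨u, Submodule.le_topologicalClosure _ hn, rfl⟩
  · exact Submodule.topologicalClosure_minimal _
      (iSup_le fun n => scaledH10_mono c (le_iSup Ω n)) (isClosed_scaledH10 c _)

/-! ### Weak solutions as projections -/

/-- Weak solutions of the Dirichlet problem are orthogonal projections onto `H¹₀(Ω)`, for the
inner product `lam ⟨u, v⟩ + ⟨∇u, ∇v⟩`. -/
lemma isWeakDirichletSolution_iff {d : ℕ} {Ω : Opens (EuclideanSpace ℝ (Fin d))} {lam : ℝ}
    {c : ℂˣ} (hc : (starRingEnd ℂ) c * c = lam) {f : EuclideanSpace ℝ (Fin d) → ℂ}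
    {g : L2Space d} (hg : ∀ᵐ x, x ∈ (Ω : Set (EuclideanSpace ℝ (Fin d))) → g x = f x)
    (u : SobolevH1 d) :
    IsWeakDirichletSolution Ω lam f u ↔
      scaledGraph d c u = (scaledH10 c Ω).starProjection
        (WithLp.toLp 2 (((starRingEnd ℂ) c)⁻¹ • g, 0)) := by
  have hcu : (starRingEnd ℂ) (c : ℂ) ≠ 0 := by simp
  -- The equation tested with `v` says that the residual is orthogonal to the image of `v`. The
  -- factor `(conj c)⁻¹` on `g` cancels the `conj c` produced by the first slot.
  have key : ∀ v ∈ SobolevH10 Ω,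
      ((lam : ℂ) * (∫ x in (Ω : Set (EuclideanSpace ℝ (Fin d))),
        sobolevFun u x * (starRingEnd ℂ) (sobolevFun v x)) +
      ∑ i, (∫ x in (Ω : Set (EuclideanSpace ℝ (Fin d))),
        weakDeriv u i x * (starRingEnd ℂ) (weakDeriv v i x)) =
      ∫ x in (Ω : Set (EuclideanSpace ℝ (Fin d))), f x * (starRingEnd ℂ) (sobolevFun v x)) ↔
      inner ℂ (scaledGraph d c v) (WithLp.toLp 2 (((starRingEnd ℂ) (c : ℂ))⁻¹ • g, 0) -
        scaledGraph d c u) = 0 := by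
    intro v hv
    obtain ⟨hv0, hv1⟩ := ae_eq_zero_of_mem_sobolevH10 hv
    have hf : ∫ x in (Ω : Set (EuclideanSpace ℝ (Fin d))),
        f x * (starRingEnd ℂ) (sobolevFun v x) = inner ℂ (sobolevFun v) g := by
      rw [← setIntegral_mul_conj_eq_inner _ g _ hv0]
      refine setIntegral_congr_ae Ω.isOpen.measurableSet ?_
      filter_upwards [hg] with x hx hxΩ
      rw [hx hxΩ]
    have h1 : inner ℂ (scaledGraph d c v) (scaledGraph d c u) =
        (lam : ℂ) * inner ℂ (sobolevFun v) (sobolevFun u) +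
          ∑ i, inner ℂ (weakDeriv v i) (weakDeriv u i) := by
      rw [← hc]
      change inner ℂ ((c : ℂ) • sobolevFun v) ((c : ℂ) • sobolevFun u) + _ = _
      rw [inner_smul_left, inner_smul_right, mul_assoc]
      rfl
    have h2 : inner ℂ (scaledGraph d c v)
        (WithLp.toLp 2 (((starRingEnd ℂ) (c : ℂ))⁻¹ • g, 0)) = inner ℂ (sobolevFun v) g := by
      change inner ℂ ((c : ℂ) • sobolevFun v) (((starRingEnd ℂ) (c : ℂ))⁻¹ • g) +
        inner ℂ (scaledGraph d c v).snd 0 = _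
      rw [inner_zero_right, add_zero, inner_smul_left, inner_smul_right, ← mul_assoc,
        mul_inv_cancel₀ hcu, one_mul]
    rw [setIntegral_mul_conj_eq_inner _ _ _ hv0, hf, inner_sub_right, h1, h2, sub_eq_zero,
      Finset.sum_congr rfl fun i _ => setIntegral_mul_conj_eq_inner _ _ _ (hv1 i)]
    exact eq_comm
  have hmem : ∀ v, scaledGraph d c v ∈ scaledH10 c Ω ↔ v ∈ SobolevH10 Ω := fun v =>
    ⟨fun ⟨w, hw, hwv⟩ => (isClosedEmbedding_scaledGraph d c).injective hwv ▸ hw,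
      fun hv => ⟨v, hv, rfl⟩⟩
  constructor
  · rintro ⟨hu, h⟩
    refine (Submodule.eq_starProjection_of_mem_orthogonal ((hmem u).2 hu) ?_).symm
    rw [Submodule.mem_orthogonal]
    rintro _ ⟨v, hv, rfl⟩
    exact (key v hv).1 (h v hv)
  · intro h
    refine ⟨(hmem u).1 (h ▸ Submodule.starProjection_apply_mem _ _), fun v hv => ?_⟩
    rw [key v hv, h]
    exact (Submodule.mem_orthogonal _ _).1 (Submodule.sub_starProjection_mem_orthogonal _) _
      ((hmem v).2 hv)

lemma existsUnique_isWeakDirichletSolution {d : ℕ} {Ω : Opens (EuclideanSpace ℝ (Fin d))}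
    {lam : ℝ} {c : ℂˣ} (hc : (starRingEnd ℂ) c * c = lam)
    {f : EuclideanSpace ℝ (Fin d) → ℂ} {g : L2Space d}
    (hg : ∀ᵐ x, x ∈ (Ω : Set (EuclideanSpace ℝ (Fin d))) → g x = f x) :
    ∃! u : SobolevH1 d, IsWeakDirichletSolution Ω lam f u := by
  obtain ⟨u, -, hu⟩ := Submodule.starProjection_apply_mem (scaledH10 c Ω)
    (WithLp.toLp 2 (((starRingEnd ℂ) c)⁻¹ • g, 0))
  refine ⟨u, (isWeakDirichletSolution_iff hc hg u).2 hu, fun v hv => ?_⟩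
  exact (isClosedEmbedding_scaledGraph d c).injective
    (((isWeakDirichletSolution_iff hc hg v).1 hv).trans hu.symm)

theorem corollary5p2 {d : ℕ} (Ω : ℕ → Opens (EuclideanSpace ℝ (Fin d))) (hΩ : Monotone Ω)
    (lam : ℝ) (hlam : 0 < lam) (f : EuclideanSpace ℝ (Fin d) → ℂ)
    (hf : MemLp f 2 (volume.restrict (⋃ n, (Ω n : Set (EuclideanSpace ℝ (Fin d)))))) :
    (∀ n, ∃! u : SobolevH1 d, IsWeakDirichletSolution (Ω n) lam f u) ∧
    (∃! u : SobolevH1 d, IsWeakDirichletSolution (⨆ n, Ω n) lam f u) ∧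
    ∀ (u : ℕ → SobolevH1 d) (uLim : SobolevH1 d),
      (∀ n, IsWeakDirichletSolution (Ω n) lam f (u n)) →
      IsWeakDirichletSolution (⨆ n, Ω n) lam f uLim →
      Tendsto (fun n => ‖sobolevFun (u n) - sobolevFun uLim‖) atTop (𝓝 0) := by
  have hmeas : MeasurableSet (⋃ n, (Ω n : Set (EuclideanSpace ℝ (Fin d)))) :=
    (isOpen_iUnion fun n => (Ω n).isOpen).measurableSet
  -- Extending `f` by zero off the union gives one vector to project for all `n` and for the limit.
  have hF := (memLp_indicator_iff_restrict hmeas).2 hf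
  have hgLim : ∀ᵐ x, x ∈ ((⨆ n, Ω n : Opens _) : Set (EuclideanSpace ℝ (Fin d))) →
      hF.toLp _ x = f x := by
    filter_upwards [hF.coeFn_toLp] with x hx hxΩ
    rw [hx, Set.indicator_of_mem ((Opens.coe_iSup Ω).subset hxΩ)]
  have hg : ∀ n, ∀ᵐ x, x ∈ (Ω n : Set (EuclideanSpace ℝ (Fin d))) → hF.toLp _ x = f x :=
    fun n => hgLim.mono fun x hx hxn => hx (le_iSup Ω n hxn)
  let c : ℂˣ := Units.mk0 ((√lam : ℝ) : ℂ) (by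
    exact_mod_cast (Real.sqrt_pos.2 hlam).ne')
  have hc : (starRingEnd ℂ) (c : ℂ) * c = lam := by
    change (starRingEnd ℂ) ((√lam : ℝ) : ℂ) * ((√lam : ℝ) : ℂ) = lam
    rw [Complex.conj_ofReal, ← Complex.ofReal_mul, Real.mul_self_sqrt hlam.le]
  refine ⟨fun n => existsUnique_isWeakDirichletSolution hc (hg n),
    existsUnique_isWeakDirichletSolution hc hgLim, fun u uLim hu huLim => ?_⟩
  have hK := scaledH10_iSup c hΩ
  have : (⨆ n, scaledH10 c (Ω n)).topologicalClosure.HasOrthogonalProjection :=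
    hK ▸ inferInstance
  have hlim := Submodule.starProjection_tendsto_closure_iSup (fun n => scaledH10 c (Ω n))
    (fun _ _ h => scaledH10_mono c (hΩ h))
    (WithLp.toLp 2 (((starRingEnd ℂ) (c : ℂ))⁻¹ • hF.toLp _, 0))
  have hu' := fun n => (isWeakDirichletSolution_iff hc (hg n) (u n)).1 (hu n)
  have huLim' := (isWeakDirichletSolution_iff hc hgLim uLim).1 huLim
  simp only [hK] at huLim'
  simp only [← hu', ← huLim'] at hlim
  -- Convergence of the images pulls back along the embedding to convergence in `H¹`.
  have hH1 : Tendsto u atTop (𝓝 uLim) :=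
    (isClosedEmbedding_scaledGraph d c).isInducing.tendsto_nhds_iff.2 hlim
  exact tendsto_iff_norm_sub_tendsto_zero.1 (((continuous_sobolevFun d).tendsto uLim).comp hH1)
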